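/- Let $Q$ be a smooth finite-dimensional manifold without boundary (Hausdorff, second countable) and let $t:Q\to\mathbb R$ be a smooth, locally trivial fibre bundle with typical fibre a smooth manifold $M$; $(t,q^i)$ denote bundle coordinates. For a smooth curve $c$ in $Q$ let $\dot c$ and $\ddot c$ be its prolongations to $TQ$ and $TTQ$. The jet manifolds $J^1Q$ and $J^2Q$ of sections of $Q\to\mathbb R$ are identified with their images in $TQ$ and $TTQ$ under the canonical imbeddings $\lambda: j^1_t s\mapsto\dot s(t)$ and $T\lambda\circ\lambda_2: j^2_t s\mapsto\ddot s(t)$, that is, $$\lambda:(t,q^i,q^i_t)\mapsto(t,q^i,\dot t=1,\dot q^i=q^i_t),\qquad T\lambda\circ\lambda_2:(t,q^i,q^i_t,q^i_{tt})\mapsto(t,q^i,\dot t=\overset{\circ}{t}=1,\dot q^i=\overset{\circ}{q}{}^i=q^i_t,\ddot t=0,\ddot q^i=q^i_{tt}).$$ A dynamic equation on $Q\to\mathbb R$ is the image $\xi(J^1Q)\subset J^2Q$ of a holonomic connection $\xi$ on $J^1Q\to\mathbb R$, i.e. of a smooth section $\xi=\partial_t+q^i_t\partial_i+\xi^i\partial^t_i$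 of $J^2Q\to J^1Q$; its solutions (motions) are the smooth local sections $c$ of $Q\to\mathbb R$, defined on open intervals, whose second order jet prolongation lives in $\xi(J^1Q)$. A second order equation on the manifold $Q$ is the image $\Xi(TQ)\subset TTQ$ of a holonomic vector field $\Xi$ on $TQ$, i.e. a smooth vector field on $TQ$ with $T\pi_Q(\Xi(v))=v$ for all $v\in TQ$, where $\pi_Q:TQ\to Q$. **Proposition 3.1.** Every dynamic equation on $Q\to\mathbb R$ is equivalent to a second order equation on the manifold $Q$. Precisely, for every holonomic connection $\xi$ on $J^1Q\to\mathbb R$ there is a holonomic vector field $\Xi$ on $TQ$ such that: 1. the component $\Xi^0$ of $\Xi$ (its value on the differential of the function $\dot t$ on $TQ$) vanishes on all of $TQ$; 2. $\Xi$ extends the section $T\lambda\circ\lambda_2\circ\xi$ from $J^1Q\subset TQ$ to $TQ$: $\Xi\circ\lambda=T\lambda\circ\lambda_2\circ\xi$, i.e. $\xi^i=\Xi^i(t,q^j,\dot t=1,\dot q^j=q^j_t)$; 3. as a subset of $TTQ$, the dynamic equation $\xi(J^1Q)$ is the part of $\Xi(TQ)$ given by $$\ddot t=0,\qquad \dot t=1,\qquad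 \ddot q^i=\Xi^i;\qquad(*)$$ 4. the two equations have the same solutions: a curve $c:J\to Q$ on an open interval $J$ is a motion of $\xi$ if and only if it is a smooth solution of $(*)$ (that is, $\ddot c$ lives in the subset $(*)$) with $t(c(s))=s$ on $J$; and every smooth solution $c:J\to Q$ of $(*)$ becomes a motion of $\xi$ after a translation $s\mapsto s+a$ of its parameter by some constant $a\in\mathbb R$. -/

import Mathlib

open scoped Manifold ContDiff

noncomputable section

namespace TimeMechanics

section Bundle

variable {E : Type*} [NormedAddCommGroup E] [NormedSpace ℝ E]
  {Q : Type*} [TopologicalSpace Q] [ChartedSpace E Q]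

/-- `τ : Q → ℝ` is a smooth (locally trivial) fibre bundle over the time axis with typical
fibre `M`: it is smooth, and every instant has an open neighbourhood `U` over which there is a
fibre preserving diffeomorphism of `τ ⁻¹ U` onto `U × M`. -/
structure IsFibreBundle (F : Type*) [NormedAddCommGroup F] [NormedSpace ℝ F]
    (M : Type*) [TopologicalSpace M] [ChartedSpace F M] (τ : Q → ℝ) : Prop where
  smooth : ContMDiff 𝓘(ℝ, E) 𝓘(ℝ, ℝ) ∞ τ
  locallyTrivial : ∀ t : ℝ, ∃ U : Set ℝ, IsOpen U ∧ t ∈ U ∧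
    ∃ ψ : OpenPartialHomeomorph Q (ℝ × M),
      ψ.source = τ ⁻¹' U ∧ ψ.target = U ×ˢ Set.univ ∧
      (∀ q ∈ ψ.source, (ψ q).1 = τ q) ∧
      ContMDiffOn 𝓘(ℝ, E) (𝓘(ℝ, ℝ).prod 𝓘(ℝ, F)) ∞ ψ ψ.source ∧
      ContMDiffOn (𝓘(ℝ, ℝ).prod 𝓘(ℝ, F)) 𝓘(ℝ, E) ∞ ψ.symm ψ.target

/-- The smooth map `s`, considered near the instant `t`, is a local section of `τ`. -/
def IsLocalSectionAt (τ : Q → ℝ) (s : ℝ → Q) (t : ℝ) : Prop :=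
  ∃ U : Set ℝ, IsOpen U ∧ t ∈ U ∧ ContMDiffOn 𝓘(ℝ, ℝ) 𝓘(ℝ, E) ∞ s U ∧ ∀ r ∈ U, τ (s r) = r

/-- The tangent prolongation `ċ` of a curve `c`, with values in `TQ`. -/
def velocity (c : ℝ → Q) (t : ℝ) : TangentBundle 𝓘(ℝ, E) Q :=
  ⟨c t, mfderiv 𝓘(ℝ, ℝ) 𝓘(ℝ, E) c t (1 : ℝ)⟩

/-- The function `ṫ` on `TQ`: the value of `dt` (pulled back to `Q`) on a tangent vector. -/
def tDot (τ : Q → ℝ) (v : TangentBundle 𝓘(ℝ, E) Q) : ℝ :=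
  mfderiv 𝓘(ℝ, E) 𝓘(ℝ, ℝ) τ v.proj v.2

/-- The first order jet manifold `J¹Q` of sections of `τ`, identified with its image in `TQ`
under the canonical imbedding `λ`, which sends the jet of a section `s` at `t` to `ṡ(t)`.
Two sections have the same first order jet at `t` exactly when these images coincide. -/
def jetOne (τ : Q → ℝ) : Set (TangentBundle 𝓘(ℝ, E) Q) :=
  {v | ∃ (t : ℝ) (s : ℝ → Q), IsLocalSectionAt (E := E) τ s t ∧ velocity (E := E) s t = v}

variable [IsManifold 𝓘(ℝ, E) ∞ Q]

/-- The second order tangent prolongation `c̈` of a curve `c`: the velocity of the curve `ċ`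
in `TQ`, an element of `TTQ`. -/
def acceleration (c : ℝ → Q) (t : ℝ) :
    TangentBundle 𝓘(ℝ, E).tangent (TangentBundle 𝓘(ℝ, E) Q) :=
  ⟨velocity (E := E) c t,
    mfderiv 𝓘(ℝ, ℝ) 𝓘(ℝ, E).tangent (velocity (E := E) c) t (1 : ℝ)⟩

/-- The function `ẗ` on `TTQ`: the derivative of the function `ṫ` along an element of `TTQ`. -/
def tDDot (τ : Q → ℝ) (w : TangentBundle 𝓘(ℝ, E).tangent (TangentBundle 𝓘(ℝ, E) Q)) : ℝ :=
  mfderiv 𝓘(ℝ, E).tangent 𝓘(ℝ, ℝ) (tDot (E := E) τ) w.proj w.2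

/-- The second order jet manifold `J²Q` of sections of `τ`, identified with its image in `TTQ`
under the canonical imbedding `Tλ ∘ λ₂`, which sends the second order jet of a section `s` at `t`
to `s̈(t)`.  Two sections have the same second order jet at `t` exactly when these images
coincide. -/
def jetTwo (τ : Q → ℝ) : Set (TangentBundle 𝓘(ℝ, E).tangent (TangentBundle 𝓘(ℝ, E) Q)) :=
  {w | ∃ (t : ℝ) (s : ℝ → Q), IsLocalSectionAt (E := E) τ s t ∧ acceleration (E := E) s t = w}

/-- A field `ξ` of tangent vectors of `TQ` at the points of the submanifold `J¹Q` is a holonomic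
connection on `J¹Q → ℝ`: it is smooth on `J¹Q` and takes its values in `J²Q`.  (Elements of `J²Q`
over `v` are tangent to `J¹Q` and project to `∂_t`, so that `ξ` is a vector field on `J¹Q` with
`ξ ⌋ dt = 1`.)  Only the values of `ξ` at the points of `J¹Q` matter.  The composition
`Tλ ∘ λ₂ ∘ ξ` is `ξ` itself, under the identifications made. -/
structure IsHolonomicConnection (τ : Q → ℝ)
    (ξ : ∀ v : TangentBundle 𝓘(ℝ, E) Q, TangentSpace 𝓘(ℝ, E).tangent v) : Prop where
  smooth : ContMDiffOn 𝓘(ℝ, E).tangent 𝓘(ℝ, E).tangent.tangent ∞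
    (fun v => (⟨v, ξ v⟩ : TangentBundle 𝓘(ℝ, E).tangent (TangentBundle 𝓘(ℝ, E) Q)))
    (jetOne (E := E) τ)
  holonomic : ∀ v ∈ jetOne (E := E) τ,
    (⟨v, ξ v⟩ : TangentBundle 𝓘(ℝ, E).tangent (TangentBundle 𝓘(ℝ, E) Q)) ∈ jetTwo (E := E) τ

/-- The dynamic equation given by a holonomic connection `ξ`: the image `ξ(J¹Q) ⊂ J²Q`. -/
def dynamicEquation (τ : Q → ℝ)
    (ξ : ∀ v : TangentBundle 𝓘(ℝ, E) Q, TangentSpace 𝓘(ℝ, E).tangent v) :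
    Set (TangentBundle 𝓘(ℝ, E).tangent (TangentBundle 𝓘(ℝ, E) Q)) :=
  (fun v => (⟨v, ξ v⟩ : TangentBundle 𝓘(ℝ, E).tangent (TangentBundle 𝓘(ℝ, E) Q))) ''
    jetOne (E := E) τ

/-- A holonomic vector field on `TQ`: a smooth vector field `Ξ` on `TQ` which the tangent map
of the projection `TQ → Q` takes to `v` at each point `v`. -/
structure IsHolonomicField
    (Ξ : ∀ v : TangentBundle 𝓘(ℝ, E) Q, TangentSpace 𝓘(ℝ, E).tangent v) : Prop where
  smooth : ContMDiff 𝓘(ℝ, E).tangent 𝓘(ℝ, E).tangent.tangent ∞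
    (fun v => (⟨v, Ξ v⟩ : TangentBundle 𝓘(ℝ, E).tangent (TangentBundle 𝓘(ℝ, E) Q)))
  holonomic : ∀ v : TangentBundle 𝓘(ℝ, E) Q,
    mfderiv 𝓘(ℝ, E).tangent 𝓘(ℝ, E)
      (fun u : TangentBundle 𝓘(ℝ, E) Q => u.proj) v (Ξ v) = v.2

/-- The second order equation on the manifold `Q` given by `Ξ`: the image `Ξ(TQ) ⊂ TTQ`. -/
def secondOrderEquation
    (Ξ : ∀ v : TangentBundle 𝓘(ℝ, E) Q, TangentSpace 𝓘(ℝ, E).tangent v) :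
    Set (TangentBundle 𝓘(ℝ, E).tangent (TangentBundle 𝓘(ℝ, E) Q)) :=
  Set.range
    (fun v => (⟨v, Ξ v⟩ : TangentBundle 𝓘(ℝ, E).tangent (TangentBundle 𝓘(ℝ, E) Q)))

/-- The equation `ẗ = 0`, `ṫ = 1`, `q̈ⁱ = Ξⁱ`: the part of the second order equation `Ξ(TQ)` cut
out by the conditions `ẗ = 0` and `ṫ = 1`. -/
def unitTimeEquation (τ : Q → ℝ)
    (Ξ : ∀ v : TangentBundle 𝓘(ℝ, E) Q, TangentSpace 𝓘(ℝ, E).tangent v) :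
    Set (TangentBundle 𝓘(ℝ, E).tangent (TangentBundle 𝓘(ℝ, E) Q)) :=
  {w | w ∈ secondOrderEquation (E := E) Ξ ∧ tDDot (E := E) τ w = 0 ∧ tDot (E := E) τ w.proj = 1}

/-- The smooth curve `c : J → Q` is a solution of the second order equation `S ⊂ TTQ`: its second
order tangent prolongation lives in `S`. -/
def IsSolution (S : Set (TangentBundle 𝓘(ℝ, E).tangent (TangentBundle 𝓘(ℝ, E) Q)))
    (J : Set ℝ) (c : ℝ → Q) : Prop :=
  ContMDiffOn 𝓘(ℝ, ℝ) 𝓘(ℝ, E) ∞ c J ∧ ∀ s ∈ J, acceleration (E := E) c s ∈ S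

/-- The curve `c : J → Q` is a motion, i.e. a solution of the dynamic equation of `ξ`: it is a
local section of `Q → ℝ`, and its second order jet prolongation lives in the image of `ξ`. -/
def IsMotion (τ : Q → ℝ)
    (ξ : ∀ v : TangentBundle 𝓘(ℝ, E) Q, TangentSpace 𝓘(ℝ, E).tangent v)
    (J : Set ℝ) (c : ℝ → Q) : Prop :=
  (∀ s ∈ J, τ (c s) = s) ∧ IsSolution (dynamicEquation (E := E) τ ξ) J c

end Bundle

end TimeMechanics

end

/-!
In bundle coordinates `(t, qⁱ, ṫ, q̇ⁱ)` of `TQ`, the submanifold `J¹Q` is `ṫ = 1`, and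
`ṫ ∂_t + q̇ⁱ ∂_i + ξⁱ(t, qʲ, q̇ʲ) ∂̇_i`, with `ξⁱ` not depending on `ṫ`, is a holonomic extension of
`ξ` with `Ξ⁰ = 0`. At each point of `TQ` the possible values of such an extension form an affine
subspace, hence a partition of unity on `TQ` glues the local extensions. Along a curve with `ṫ = 1`
the time differs from the parameter by a constant, which the translation removes.
-/

noncomputable section

namespace TimeMechanics

open Set Filter Topology Bundle Manifold

section Topology

variable {B F : Type*} {V : B → Type*} [TopologicalSpace B] [TopologicalSpace F]
  [∀ b, TopologicalSpace (V b)] [TopologicalSpace (TotalSpace F V)] [FiberBundle F V]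

theorem t2Space_totalSpace [T2Space B] [T2Space F] : T2Space (TotalSpace F V) := by
  refine ⟨fun x y hxy => ?_⟩
  by_cases h : x.proj = y.proj
  · let e := trivializationAt F V x.proj
    have hx : x ∈ e.source := FiberBundle.mem_trivializationAt_proj_source
    have hy : y ∈ e.source := e.mem_source.2 (h ▸ mem_baseSet_trivializationAt F V x.proj)
    have hne : e x ≠ e y := fun h' => hxy (e.injOn hx hy h')
    obtain ⟨u, v, hu, hv, hxu, hyv, huv⟩ := t2_separation hne
    exact ⟨_, _, e.isOpen_inter_preimage hu, e.isOpen_inter_preimage hv, ⟨hx, hxu⟩, ⟨hy, hyv⟩,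
      (huv.preimage e).mono inter_subset_right inter_subset_right⟩
  · have hπ := FiberBundle.continuous_proj F V
    obtain ⟨u, v, hu, hv, hxu, hyv, huv⟩ := t2_separation h
    exact ⟨_, _, hu.preimage hπ, hv.preimage hπ, hxu, hyv, huv.preimage _⟩

theorem secondCountableTopology_totalSpace [SecondCountableTopology B]
    [SecondCountableTopology F] : SecondCountableTopology (TotalSpace F V) := by
  obtain ⟨s, hs, hsB⟩ := TopologicalSpace.countable_cover_nhds fun b : B =>
    (trivializationAt F V b).open_baseSet.mem_nhds (mem_baseSet_trivializationAt F V b)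
  have : Countable s := hs.to_subtype
  have (b : s) : SecondCountableTopology (trivializationAt F V b.1).source :=
    (trivializationAt F V b.1).toOpenPartialHomeomorph.secondCountableTopology_source
  refine TopologicalSpace.secondCountableTopology_of_countable_cover
    (fun b : s => (trivializationAt F V b.1).open_source) (eq_univ_of_forall fun x => ?_)
  obtain ⟨b, hb, hxb⟩ := mem_iUnion₂.1 (hsB ▸ mem_univ x.proj)
  exact mem_iUnion.2 ⟨⟨b, hb⟩, (trivializationAt F V b).mem_source.2 hxb⟩

end Topology

section SmoothChart

variable {E : Type*} [NormedAddCommGroup E] [NormedSpace ℝ E]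
  {H : Type*} [TopologicalSpace H] {I : ModelWithCorners ℝ E H}
  {N : Type*} [TopologicalSpace N] [ChartedSpace H N]
  {G : Type*} [NormedAddCommGroup G] [NormedSpace ℝ G]
  {e : OpenPartialHomeomorph N G}

variable (I) in
/-- `e` is a chart of the manifold `N` with values in the normed space `G`, compatible with its
smooth structure. -/
structure IsSmoothChart (e : OpenPartialHomeomorph N G) : Prop where
  contMDiffOn : ContMDiffOn I 𝓘(ℝ, G) ∞ e e.source
  contMDiffOn_symm : ContMDiffOn 𝓘(ℝ, G) I ∞ e.symm e.target

theorem IsSmoothChart.mdifferentiable (he : IsSmoothChart I e) : e.MDifferentiable I 𝓘(ℝ, G) :=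
  ⟨he.contMDiffOn.mdifferentiableOn (by simp), he.contMDiffOn_symm.mdifferentiableOn (by simp)⟩

theorem contMDiff_totalSpaceMk_self :
    ContMDiff 𝓘(ℝ, G × G) 𝓘(ℝ, G).tangent ∞
      (fun z : G × G => (⟨z.1, z.2⟩ : TangentBundle 𝓘(ℝ, G) G)) := by
  refine fun z => contMDiffAt_totalSpace.2 ⟨contDiff_fst.contMDiff.contMDiffAt, ?_⟩
  convert! (contDiff_snd (𝕜 := ℝ) (n := ∞) (E := G) (F := G)).contMDiff.contMDiffAt with _
  simp only [trivializationAt_model_space_apply]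
  rfl

theorem mfderiv_clm_comp {G' : Type*} [NormedAddCommGroup G'] [NormedSpace ℝ G'] (L : G →L[ℝ] G')
    {f : N → G} {p : N} (hf : MDifferentiableAt I 𝓘(ℝ, G) f p) (w : TangentSpace I p) :
    (mfderiv I 𝓘(ℝ, G') (L ∘ f) p w : G') = L (mfderiv I 𝓘(ℝ, G) f p w) := by
  rw [mfderiv_comp_apply p L.mdifferentiableAt hf, L.mfderiv_eq]
  rfl

variable [IsManifold I ∞ N]

theorem contMDiffOn_tangentMap {E' : Type*} [NormedAddCommGroup E'] [NormedSpace ℝ E']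
    {H' : Type*} [TopologicalSpace H'] {I' : ModelWithCorners ℝ E' H'}
    {N' : Type*} [TopologicalSpace N'] [ChartedSpace H' N'] [IsManifold I' ∞ N']
    {f : N → N'} {s : Set N} (hf : ContMDiffOn I I' ∞ f s) (hs : IsOpen s) :
    ContMDiffOn I.tangent I'.tangent ∞ (tangentMap I I' f) (TotalSpace.proj ⁻¹' s) :=
  (hf.contMDiffOn_tangentMapWithin le_rfl hs.uniqueMDiffOn).congr fun _ hp =>
    (tangentMapWithin_eq_tangentMap (hs.uniqueMDiffOn _ hp)
      ((hf.contMDiffAt (hs.mem_nhds hp)).mdifferentiableAt (by simp))).symm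

theorem contMDiffOn_prodMk_mfderiv {f : N → G} {s : Set N} (hf : ContMDiffOn I 𝓘(ℝ, G) ∞ f s)
    (hs : IsOpen s) :
    ContMDiffOn I.tangent 𝓘(ℝ, G × G) ∞
      (fun v : TangentBundle I N => (f v.proj, (mfderiv I 𝓘(ℝ, G) f v.proj v.2 : G)))
      (TotalSpace.proj ⁻¹' s) :=
  (hf.comp (contMDiff_proj (TangentSpace I : N → Type _)).contMDiffOn fun _ h => h).prodMk_space
    ((contMDiff_snd_tangentBundle_modelSpace G 𝓘(ℝ, G)).comp_contMDiffOn
      (contMDiffOn_tangentMap hf hs))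

theorem contMDiffOn_totalSpaceMk_mfderiv {f : G → N} {s : Set G}
    (hf : ContMDiffOn 𝓘(ℝ, G) I ∞ f s) (hs : IsOpen s) :
    ContMDiffOn 𝓘(ℝ, G × G) I.tangent ∞
      (fun z : G × G => (⟨f z.1, mfderiv 𝓘(ℝ, G) I f z.1 z.2⟩ : TangentBundle I N))
      (Prod.fst ⁻¹' s) :=
  (contMDiffOn_tangentMap hf hs).comp contMDiff_totalSpaceMk_self.contMDiffOn fun _ h => h

namespace IsSmoothChart

/-- The chart of the tangent bundle induced by a smooth chart `e` of its base. -/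
def tangentChart (he : IsSmoothChart I e) :
    OpenPartialHomeomorph (TangentBundle I N) (G × G) where
  toFun v := (e v.proj, mfderiv I 𝓘(ℝ, G) e v.proj v.2)
  invFun z := ⟨e.symm z.1, mfderiv 𝓘(ℝ, G) I e.symm z.1 z.2⟩
  source := TotalSpace.proj ⁻¹' e.source
  target := Prod.fst ⁻¹' e.target
  map_source' _ hv := e.map_source hv
  map_target' _ hz := e.map_target hz
  left_inv' v hv := TotalSpace.ext (e.left_inv hv)
    (heq_of_eq ((he.mdifferentiable.mfderiv hv).left_inv v.2))
  right_inv' z hz := Prod.ext (e.right_inv hz)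
    (congrArg (· z.2) (he.mdifferentiable.comp_symm_deriv hz))
  open_source := e.open_source.preimage (FiberBundle.continuous_proj E _)
  open_target := e.open_target.preimage continuous_fst
  continuousOn_toFun := (contMDiffOn_prodMk_mfderiv he.contMDiffOn e.open_source).continuousOn
  continuousOn_invFun :=
    (contMDiffOn_totalSpaceMk_mfderiv he.contMDiffOn_symm e.open_target).continuousOn

theorem isSmoothChart_tangentChart (he : IsSmoothChart I e) :
    IsSmoothChart I.tangent he.tangentChart :=
  ⟨contMDiffOn_prodMk_mfderiv he.contMDiffOn e.open_source,
    contMDiffOn_totalSpaceMk_mfderiv he.contMDiffOn_symm e.open_target⟩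

theorem fst_mfderiv_tangentChart (he : IsSmoothChart I e) {v : TangentBundle I N}
    (hv : v ∈ he.tangentChart.source) (w : TangentSpace I.tangent v) :
    (mfderiv I.tangent 𝓘(ℝ, G × G) he.tangentChart v w : G × G).1 =
      mfderiv I 𝓘(ℝ, G) e v.proj
        (mfderiv I.tangent I (TotalSpace.proj : TangentBundle I N → N) v w) := by
  have hπ : MDifferentiableAt I.tangent I (TotalSpace.proj : TangentBundle I N → N) v :=
    (contMDiff_proj (n := ∞) (TangentSpace I : N → Type _)).mdifferentiableAt (by simp)
  have hΦ := he.isSmoothChart_tangentChart.mdifferentiable.mdifferentiableAt hv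
  rw [← mfderiv_comp_apply v (he.mdifferentiable.mdifferentiableAt hv) hπ]
  exact (mfderiv_clm_comp (.fst ℝ G G) hΦ w).symm

theorem exists_contMDiffOn_mfderiv_eq (he : IsSmoothChart I e) {Y : G → G}
    (hY : ContDiffOn ℝ ∞ Y e.target) :
    ∃ Ξ : ∀ p : N, TangentSpace I p,
      ContMDiffOn I I.tangent ∞ (fun p => (⟨p, Ξ p⟩ : TangentBundle I N)) e.source ∧
      ∀ p ∈ e.source, mfderiv I 𝓘(ℝ, G) e p (Ξ p) = Y (e p) := by
  refine ⟨fun p => mfderiv 𝓘(ℝ, G) I e.symm (e p) (Y (e p)), ?_, fun p hp => ?_⟩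
  · refine ((contMDiffOn_totalSpaceMk_mfderiv he.contMDiffOn_symm e.open_target).comp
      ((contDiffOn_id.prodMk hY).contMDiffOn.comp he.contMDiffOn fun _ hp => e.map_source hp)
      fun _ hp => e.map_source hp).congr fun p hp => ?_
    exact TotalSpace.ext (e.left_inv hp).symm HEq.rfl
  · have h := congrArg (· (Y (e p))) (he.mdifferentiable.comp_symm_deriv (e.map_source hp))
    rw [e.left_inv hp] at h
    exact h

end IsSmoothChart

end SmoothChart

section AdaptedChart

variable {E : Type*} [NormedAddCommGroup E] [NormedSpace ℝ E]
  {Q : Type*} [TopologicalSpace Q] [ChartedSpace E Q]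
  {F : Type*} [NormedAddCommGroup F] [NormedSpace ℝ F]
  {τ : Q → ℝ} {χ : OpenPartialHomeomorph Q (ℝ × F)}

/-- `χ` is a chart of `Q` adapted to the time function `τ`: a system of bundle coordinates
`(t, qⁱ)`, the coordinates `qⁱ` being gathered in a single one with values in `F`. -/
structure IsAdaptedChart (τ : Q → ℝ) (χ : OpenPartialHomeomorph Q (ℝ × F)) : Prop
    extends IsSmoothChart 𝓘(ℝ, E) χ where
  fst_eq : ∀ q ∈ χ.source, (χ q).1 = τ q

theorem IsFibreBundle.exists_adaptedChart {M : Type*} [TopologicalSpace M] [ChartedSpace F M]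
    [IsManifold 𝓘(ℝ, F) ∞ M] (hτ : IsFibreBundle (E := E) F M τ) (q : Q) :
    ∃ χ : OpenPartialHomeomorph Q (ℝ × F), q ∈ χ.source ∧ IsAdaptedChart (E := E) τ χ := by
  obtain ⟨U, -, hqU, ψ, hψ, -, hfst, hsmooth, hsmooth_symm⟩ := hτ.locallyTrivial (τ q)
  have hq : q ∈ ψ.source := hψ ▸ hqU
  let φ := chartAt F (ψ q).2
  refine ⟨ψ.trans ((OpenPartialHomeomorph.refl ℝ).prod φ), ?_, ⟨?_, ?_⟩, fun x hx => hfst x hx.1⟩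
  · simp [hq, φ]
  · refine ContMDiffOn.prodMk_space
      (contMDiff_fst.comp_contMDiffOn (hsmooth.mono fun x hx => hx.1)) ?_
    exact (contMDiffOn_chart (I := 𝓘(ℝ, F)) (x := (ψ q).2)).comp
      (contMDiff_snd.comp_contMDiffOn (hsmooth.mono fun x hx => hx.1)) fun x hx => hx.2.2
  · have hφ := (contMDiffOn_chart_symm (I := 𝓘(ℝ, F)) (n := ∞) (x := (ψ q).2)).comp
      (contDiff_snd (E := ℝ)).contMDiff.contMDiffOn fun x hx => hx
    refine hsmooth_symm.comp
      ((contDiff_fst.contMDiff.contMDiffOn.prodMk hφ).mono fun x hx => hx.1.2) fun x hx => hx.2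

theorem exists_adaptedChart {q : Q}
    (hτ : IsSubmersionAtOfComplement F 𝓘(ℝ, E) 𝓘(ℝ, ℝ) ∞ τ q) :
    ∃ χ : OpenPartialHomeomorph Q (ℝ × F), q ∈ χ.source ∧ IsAdaptedChart (E := E) τ χ := by
  let φ := hτ.domChart
  let κ := hτ.codChart
  let L := hτ.equiv
  have hφ := contMDiffOn_of_mem_maximalAtlas hτ.domChart_mem_maximalAtlas
  have hφ_symm := contMDiffOn_symm_of_mem_maximalAtlas hτ.domChart_mem_maximalAtlas
  have hκ := contMDiffOn_of_mem_maximalAtlas hτ.codChart_mem_maximalAtlas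
  have hκ_symm := contMDiffOn_symm_of_mem_maximalAtlas hτ.codChart_mem_maximalAtlas
  have hfst (x : Q) (hx : x ∈ φ.source) : (L (φ x)).1 = κ (τ x) := by
    have h := hτ.writtenInCharts (by simpa using φ.map_source hx : φ x ∈ _)
    simpa [φ, φ.left_inv hx] using h.symm
  have hτκ (x : Q) (hx : x ∈ φ.source) : τ x ∈ κ.source := hτ.source_subset_preimage_source hx
  have hκL (x : Q) (hx : x ∈ φ.source) : (L (φ x)).1 ∈ κ.target :=
    hfst x hx ▸ κ.map_source (hτκ x hx)
  refine ⟨(φ.transHomeomorph L.toHomeomorph).trans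
    (κ.symm.prod (OpenPartialHomeomorph.refl F)), ?_, ⟨?_, ?_⟩, fun x hx => ?_⟩
  · exact ⟨hτ.mem_domChart_source, hκL q hτ.mem_domChart_source, mem_univ _⟩
  · have hL := L.contDiff.contMDiff.comp_contMDiffOn hφ
    exact ((hκ_symm.comp (contDiff_fst.contMDiff.comp_contMDiffOn hL) hκL).prodMk_space
      (contDiff_snd.contMDiff.comp_contMDiffOn hL)).mono fun x hx => hx.1
  · have hκχ := (hκ.comp (contDiff_fst (F := F)).contMDiff.contMDiffOn fun _ h => h).prodMk_space
      (contDiff_snd (𝕜 := ℝ) (n := ∞)).contMDiff.contMDiffOn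
    exact hφ_symm.comp (L.symm.contDiff.contMDiff.comp_contMDiffOn (hκχ.mono fun x hx => hx.1.1))
      fun x hx => hx.2
  · exact (congrArg κ.symm (hfst x hx.1)).trans (κ.left_inv (hτκ x hx.1))

variable [IsManifold 𝓘(ℝ, E) ∞ Q]

theorem IsAdaptedChart.isSubmersionAtOfComplement (hχ : IsAdaptedChart (E := E) τ χ) {q : Q}
    (hq : q ∈ χ.source) : IsSubmersionAtOfComplement F 𝓘(ℝ, E) 𝓘(ℝ, ℝ) ∞ τ q := by
  let L : E ≃L[ℝ] ℝ × F := hχ.mdifferentiable.mfderiv hq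
  refine .mk_of_charts L (χ.transHomeomorph L.symm.toHomeomorph) (.refl ℝ) hq
    (mem_univ _) (OpenPartialHomeomorph.mem_maximalAtlas_of_contMDiffOn _ ?_ ?_)
    (IsManifold.chart_mem_maximalAtlas (0 : ℝ)) (subset_univ _) fun x hx => ?_
  · exact L.symm.contDiff.contMDiff.comp_contMDiffOn hχ.contMDiffOn
  · exact hχ.contMDiffOn_symm.comp L.contDiff.contMDiff.contMDiffOn fun x hx => hx
  · have hLx : L x ∈ χ.target := by simpa using hx
    have h := hχ.fst_eq _ (χ.map_target hLx)
    rw [χ.right_inv hLx] at h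
    simpa using h.symm

theorem IsFibreBundle.isSubmersion {M : Type*} [TopologicalSpace M] [ChartedSpace F M]
    [IsManifold 𝓘(ℝ, F) ∞ M] (hτ : IsFibreBundle (E := E) F M τ) :
    IsSubmersion 𝓘(ℝ, E) 𝓘(ℝ, ℝ) ∞ τ :=
  IsSubmersionOfComplement.isSubmersion fun q =>
    let ⟨_, hq, hχ⟩ := hτ.exists_adaptedChart q
    hχ.isSubmersionAtOfComplement hq

end AdaptedChart

section Jets

variable {E : Type*} [NormedAddCommGroup E] [NormedSpace ℝ E]
  {Q : Type*} [TopologicalSpace Q] [ChartedSpace E Q]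
  {F : Type*} [NormedAddCommGroup F] [NormedSpace ℝ F]
  {τ : Q → ℝ} {χ : OpenPartialHomeomorph Q (ℝ × F)}

theorem IsAdaptedChart.fst_mfderiv (hχ : IsAdaptedChart (E := E) τ χ)
    {v : TangentBundle 𝓘(ℝ, E) Q} (hv : v.proj ∈ χ.source) :
    (mfderiv 𝓘(ℝ, E) 𝓘(ℝ, ℝ × F) χ v.proj v.2 : ℝ × F).1 = tDot (E := E) τ v := by
  have h : Prod.fst ∘ χ =ᶠ[𝓝 v.proj] τ :=
    (χ.open_source.eventually_mem hv).mono fun q hq => hχ.fst_eq q hq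
  rw [tDot, ← h.mfderiv_eq]
  exact (mfderiv_clm_comp (.fst ℝ ℝ F) (hχ.mdifferentiable.mdifferentiableAt hv) v.2).symm

theorem velocity_comp {E' : Type*} [NormedAddCommGroup E'] [NormedSpace ℝ E']
    {N : Type*} [TopologicalSpace N] [ChartedSpace E' N] {g : N → Q} {c : ℝ → N} {t : ℝ}
    (hg : MDifferentiableAt 𝓘(ℝ, E') 𝓘(ℝ, E) g (c t))
    (hc : MDifferentiableAt 𝓘(ℝ, ℝ) 𝓘(ℝ, E') c t) :
    velocity (E := E) (g ∘ c) t = tangentMap 𝓘(ℝ, E') 𝓘(ℝ, E) g (velocity (E := E') c t) :=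
  congrArg (TotalSpace.mk (g (c t))) (mfderiv_comp_apply t hg hc (1 : ℝ))

theorem velocity_eq_of_hasDerivAt {γ : ℝ → E} {u : E} {t : ℝ} (h : HasDerivAt γ u t) :
    velocity (E := E) γ t = ⟨γ t, u⟩ := by
  refine congrArg (TotalSpace.mk (γ t)) ?_
  rw [mfderiv_eq_fderiv]
  exact h.hasFDerivAt.fderiv ▸ one_smul ℝ u

theorem tDot_velocity {c : ℝ → Q} {t : ℝ} (hτ : MDifferentiable 𝓘(ℝ, E) 𝓘(ℝ, ℝ) τ)
    (hc : MDifferentiableAt 𝓘(ℝ, ℝ) 𝓘(ℝ, E) c t) :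
    tDot (E := E) τ (velocity (E := E) c t) = deriv (τ ∘ c) t := by
  rw [← fderiv_apply_one_eq_deriv, ← mfderiv_eq_fderiv]
  exact (mfderiv_comp_apply t (hτ (c t)) hc (1 : ℝ)).symm

theorem IsLocalSectionAt.mdifferentiableAt {s : ℝ → Q} {t : ℝ}
    (hs : IsLocalSectionAt (E := E) τ s t) : MDifferentiableAt 𝓘(ℝ, ℝ) 𝓘(ℝ, E) s t :=
  let ⟨_, hU, ht, hs, _⟩ := hs
  (hs.contMDiffAt (hU.mem_nhds ht)).mdifferentiableAt (by simp)

theorem IsLocalSectionAt.eventually {s : ℝ → Q} {t : ℝ}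
    (hs : IsLocalSectionAt (E := E) τ s t) : ∀ᶠ r in 𝓝 t, IsLocalSectionAt (E := E) τ s r :=
  let ⟨U, hU, ht, hs, hτs⟩ := hs
  (hU.eventually_mem ht).mono fun _ hr => ⟨U, hU, hr, hs, hτs⟩

theorem IsLocalSectionAt.tDot_velocity_eq_one {s : ℝ → Q} {t : ℝ}
    (hs : IsLocalSectionAt (E := E) τ s t) (hτ : MDifferentiable 𝓘(ℝ, E) 𝓘(ℝ, ℝ) τ) :
    tDot (E := E) τ (velocity (E := E) s t) = 1 := by
  have h : τ ∘ s =ᶠ[𝓝 t] id := hs.eventually.mono fun r hr =>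
    let ⟨_, _, hrU, _, hτs⟩ := hr
    hτs r hrU
  rw [tDot_velocity hτ hs.mdifferentiableAt, h.deriv_eq, deriv_id]

theorem tDot_of_mem_jetOne (hτ : MDifferentiable 𝓘(ℝ, E) 𝓘(ℝ, ℝ) τ)
    {v : TangentBundle 𝓘(ℝ, E) Q} (hv : v ∈ jetOne (E := E) τ) : tDot (E := E) τ v = 1 := by
  obtain ⟨t, s, hs, rfl⟩ := hv
  exact hs.tDot_velocity_eq_one hτ

theorem IsAdaptedChart.mem_jetOne (hχ : IsAdaptedChart (E := E) τ χ)
    {v : TangentBundle 𝓘(ℝ, E) Q} (hv : v.proj ∈ χ.source) (h1 : tDot (E := E) τ v = 1) :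
    v ∈ jetOne (E := E) τ := by
  -- `v` is the velocity of a straight line in the chart.
  let u : ℝ × F := mfderiv 𝓘(ℝ, E) 𝓘(ℝ, ℝ × F) χ v.proj v.2
  let t := τ v.proj
  let γ : ℝ → ℝ × F := fun r => χ v.proj + (r - t) • u
  have hu : u.1 = 1 := (hχ.fst_mfderiv hv).trans h1
  have hγ : ContDiff ℝ ∞ γ := by fun_prop
  have hγt : γ t = χ v.proj := by simp [γ]
  have hγ' : HasDerivAt γ u t := by
    simpa [γ] using (((hasDerivAt_id t).sub_const t).smul_const u).const_add (χ v.proj)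
  have htarget : γ t ∈ χ.target := hγt ▸ χ.map_source hv
  refine ⟨t, χ.symm ∘ γ, ⟨γ ⁻¹' χ.target, χ.open_target.preimage hγ.continuous, htarget,
    hχ.contMDiffOn_symm.comp hγ.contMDiff.contMDiffOn fun _ h => h, fun r hr => ?_⟩, ?_⟩
  · rw [Function.comp_apply, ← hχ.fst_eq _ (χ.map_target hr), χ.right_inv hr]
    simp [γ, hu, hχ.fst_eq _ hv, t]
  · rw [velocity_comp (hχ.mdifferentiable.mdifferentiableAt_symm htarget)
      (hγ'.differentiableAt.mdifferentiableAt), velocity_eq_of_hasDerivAt hγ', hγt]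
    exact TotalSpace.ext (χ.left_inv hv)
      (heq_of_eq ((hχ.mdifferentiable.mfderiv hv).left_inv v.2))

theorem mem_jetOne_iff (hτ : IsSubmersion 𝓘(ℝ, E) 𝓘(ℝ, ℝ) ∞ τ) {v : TangentBundle 𝓘(ℝ, E) Q} :
    v ∈ jetOne (E := E) τ ↔ tDot (E := E) τ v = 1 := by
  obtain ⟨χ, hv, hχ⟩ := exists_adaptedChart (hτ.isSubmersionOfComplement_complement v.proj)
  exact ⟨tDot_of_mem_jetOne (hτ.contMDiff.mdifferentiable (by simp)), hχ.mem_jetOne hv⟩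

variable [IsManifold 𝓘(ℝ, E) ∞ Q]

theorem mdifferentiable_tDot (hτ : ContMDiff 𝓘(ℝ, E) 𝓘(ℝ, ℝ) ∞ τ) :
    MDifferentiable 𝓘(ℝ, E).tangent 𝓘(ℝ, ℝ) (tDot (E := E) τ) :=
  ((contMDiff_snd_tangentBundle_modelSpace ℝ 𝓘(ℝ, ℝ)).comp
    (hτ.contMDiff_tangentMap (m := ∞) le_rfl)).mdifferentiable (by simp)

theorem IsLocalSectionAt.mdifferentiableAt_velocity {s : ℝ → Q} {t : ℝ}
    (hs : IsLocalSectionAt (E := E) τ s t) :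
    MDifferentiableAt 𝓘(ℝ, ℝ) 𝓘(ℝ, E).tangent (velocity (E := E) s) t := by
  obtain ⟨U, hU, ht, hs, -⟩ := hs
  have h := (contMDiffOn_totalSpaceMk_mfderiv hs hU).comp
    (contDiff_prodMk_left (𝕜 := ℝ) (n := ∞) (1 : ℝ)).contMDiff.contMDiffOn fun _ h => h
  exact (h.contMDiffAt (hU.mem_nhds ht)).mdifferentiableAt (by simp)

theorem mfderiv_proj_of_mem_jetTwo
    {w : TangentBundle 𝓘(ℝ, E).tangent (TangentBundle 𝓘(ℝ, E) Q)} (hw : w ∈ jetTwo (E := E) τ) :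
    mfderiv 𝓘(ℝ, E).tangent 𝓘(ℝ, E) (fun u : TangentBundle 𝓘(ℝ, E) Q => u.proj) w.proj w.2 =
      w.proj.2 := by
  obtain ⟨t, s, hs, rfl⟩ := hw
  have hπ : MDifferentiable 𝓘(ℝ, E).tangent 𝓘(ℝ, E)
      (fun u : TangentBundle 𝓘(ℝ, E) Q => u.proj) :=
    (contMDiff_proj (n := ∞) (TangentSpace 𝓘(ℝ, E) : Q → Type _)).mdifferentiable (by simp)
  exact (mfderiv_comp_apply t (hπ _) hs.mdifferentiableAt_velocity (1 : ℝ)).symm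

theorem tDDot_of_mem_jetTwo (hτ : ContMDiff 𝓘(ℝ, E) 𝓘(ℝ, ℝ) ∞ τ)
    {w : TangentBundle 𝓘(ℝ, E).tangent (TangentBundle 𝓘(ℝ, E) Q)} (hw : w ∈ jetTwo (E := E) τ) :
    tDDot (E := E) τ w = 0 := by
  obtain ⟨t, s, hs, rfl⟩ := hw
  have h : tDot (E := E) τ ∘ velocity (E := E) s =ᶠ[𝓝 t] fun _ => (1 : ℝ) :=
    hs.eventually.mono fun r hr => hr.tDot_velocity_eq_one (hτ.mdifferentiable (by simp))
  have h' := mfderiv_comp_apply t (mdifferentiable_tDot hτ (velocity (E := E) s t))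
    hs.mdifferentiableAt_velocity (1 : ℝ)
  rw [h.mfderiv_eq, mfderiv_const] at h'
  exact h'.symm

end Jets

section LocalExtension

variable {E : Type*} [NormedAddCommGroup E] [NormedSpace ℝ E]
  {Q : Type*} [TopologicalSpace Q] [ChartedSpace E Q] [IsManifold 𝓘(ℝ, E) ∞ Q]
  {F : Type*} [NormedAddCommGroup F] [NormedSpace ℝ F]
  {τ : Q → ℝ} {χ : OpenPartialHomeomorph Q (ℝ × F)}
  {ξ : ∀ v : TangentBundle 𝓘(ℝ, E) Q, TangentSpace 𝓘(ℝ, E).tangent v}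

/-- The holonomic tangent vectors of `TQ` at `v` with `ẗ = 0` which agree with `ξ` on `J¹Q`:
the candidates for the value at `v` of the vector field extending `ξ`. -/
def holonomicExtensions (τ : Q → ℝ)
    (ξ : ∀ v : TangentBundle 𝓘(ℝ, E) Q, TangentSpace 𝓘(ℝ, E).tangent v)
    (v : TangentBundle 𝓘(ℝ, E) Q) : Set (TangentSpace 𝓘(ℝ, E).tangent v) :=
  {w | mfderiv 𝓘(ℝ, E).tangent 𝓘(ℝ, E) (fun u : TangentBundle 𝓘(ℝ, E) Q => u.proj) v w = v.2 ∧
    tDDot (E := E) τ ⟨v, w⟩ = 0 ∧ (v ∈ jetOne (E := E) τ → w = ξ v)}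

theorem convex_holonomicExtensions (v : TangentBundle 𝓘(ℝ, E) Q) :
    Convex ℝ (holonomicExtensions (E := E) τ ξ v) := by
  let Dproj := mfderiv 𝓘(ℝ, E).tangent 𝓘(ℝ, E) (fun u : TangentBundle 𝓘(ℝ, E) Q => u.proj) v
  let DtDot := mfderiv 𝓘(ℝ, E).tangent 𝓘(ℝ, ℝ) (tDot (E := E) τ) v
  have hproj : Convex ℝ {w | Dproj w = v.2} :=
    (convex_singleton v.2).linear_preimage Dproj.toLinearMap
  have htDDot : Convex ℝ {w | DtDot w = 0} :=
    (convex_singleton 0).linear_preimage DtDot.toLinearMap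
  have hext : Convex ℝ {w | v ∈ jetOne (E := E) τ → w = ξ v} := by
    by_cases hv : v ∈ jetOne (E := E) τ <;> simp [hv, convex_singleton, convex_univ]
  exact hproj.inter (htDDot.inter hext)

namespace IsAdaptedChart

variable (hχ : IsAdaptedChart (E := E) τ χ) {v : TangentBundle 𝓘(ℝ, E) Q}

include hχ

theorem snd_fst_tangentChart (hv : v ∈ hχ.tangentChart.source) :
    (hχ.tangentChart v).2.1 = tDot (E := E) τ v :=
  hχ.fst_mfderiv hv

theorem snd_fst_mfderiv_tangentChart (hv : v ∈ hχ.tangentChart.source)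
    (w : TangentSpace 𝓘(ℝ, E).tangent v) :
    (mfderiv 𝓘(ℝ, E).tangent 𝓘(ℝ, (ℝ × F) × (ℝ × F)) hχ.tangentChart v w :
      (ℝ × F) × (ℝ × F)).2.1 = tDDot (E := E) τ ⟨v, w⟩ := by
  have h : (fun z : (ℝ × F) × (ℝ × F) => z.2.1) ∘ hχ.tangentChart =ᶠ[𝓝 v] tDot (E := E) τ :=
    (hχ.tangentChart.open_source.eventually_mem hv).mono fun _ => hχ.snd_fst_tangentChart
  rw [tDDot, ← h.mfderiv_eq]
  exact (mfderiv_clm_comp (.comp (.fst ℝ ℝ F) (.snd ℝ (ℝ × F) (ℝ × F)))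
    (hχ.isSmoothChart_tangentChart.mdifferentiable.mdifferentiableAt hv) w).symm

theorem mfderiv_tangentChart_eq_iff (hv : v ∈ hχ.tangentChart.source)
    {w : TangentSpace 𝓘(ℝ, E).tangent v} {a : F} :
    (mfderiv 𝓘(ℝ, E).tangent 𝓘(ℝ, (ℝ × F) × (ℝ × F)) hχ.tangentChart v w :
        (ℝ × F) × (ℝ × F)) = ((hχ.tangentChart v).2, (0, a)) ↔
      mfderiv 𝓘(ℝ, E).tangent 𝓘(ℝ, E) (fun u : TangentBundle 𝓘(ℝ, E) Q => u.proj) v w = v.2 ∧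
      tDDot (E := E) τ ⟨v, w⟩ = 0 ∧
      (mfderiv 𝓘(ℝ, E).tangent 𝓘(ℝ, (ℝ × F) × (ℝ × F)) hχ.tangentChart v w :
        (ℝ × F) × (ℝ × F)).2.2 = a := by
  refine Prod.ext_iff.trans (and_congr ?_ (Prod.ext_iff.trans (and_congr_left' ?_)))
  · exact (Eq.congr_left (hχ.fst_mfderiv_tangentChart hv w)).trans
      (hχ.mdifferentiable.mfderiv_injective hv).eq_iff
  · exact Eq.congr_left (hχ.snd_fst_mfderiv_tangentChart hv w)

omit hχ in
/-- The vertical accelerations `ξⁱ(t, qʲ, qʲ_t)` of `ξ` in an adapted chart, as a function of all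
the coordinates `(t, qʲ, ṫ, q̇ʲ)` of `TQ` which does not depend on `ṫ`. -/
def verticalAcceleration (hχ : IsAdaptedChart (E := E) τ χ)
    (ξ : ∀ v : TangentBundle 𝓘(ℝ, E) Q, TangentSpace 𝓘(ℝ, E).tangent v)
    (z : (ℝ × F) × (ℝ × F)) : F :=
  let v := hχ.tangentChart.symm (z.1, (1, z.2.2))
  (mfderiv 𝓘(ℝ, E).tangent 𝓘(ℝ, (ℝ × F) × (ℝ × F)) hχ.tangentChart v (ξ v) :
    (ℝ × F) × (ℝ × F)).2.2

theorem verticalAcceleration_tangentChart (hv : v ∈ hχ.tangentChart.source)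
    (h1 : tDot (E := E) τ v = 1) :
    hχ.verticalAcceleration ξ (hχ.tangentChart v) =
      (mfderiv 𝓘(ℝ, E).tangent 𝓘(ℝ, (ℝ × F) × (ℝ × F)) hχ.tangentChart v (ξ v) :
        (ℝ × F) × (ℝ × F)).2.2 := by
  have h : ((hχ.tangentChart v).1, ((1 : ℝ), (hχ.tangentChart v).2.2)) = hχ.tangentChart v := by
    rw [← h1, ← hχ.snd_fst_tangentChart hv]
  rw [verticalAcceleration, h, hχ.tangentChart.left_inv hv]

theorem contDiffOn_verticalAcceleration (hξ : IsHolonomicConnection (E := E) τ ξ) :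
    ContDiffOn ℝ ∞ (hχ.verticalAcceleration ξ) hχ.tangentChart.target := by
  let Φ := hχ.tangentChart
  have hΦ : IsSmoothChart 𝓘(ℝ, E).tangent Φ := hχ.isSmoothChart_tangentChart
  let normalize : (ℝ × F) × (ℝ × F) → (ℝ × F) × (ℝ × F) := fun z => (z.1, (1, z.2.2))
  have hnormalize : ContDiff ℝ ∞ normalize := by fun_prop
  have hjet : MapsTo (Φ.symm ∘ normalize) Φ.target (jetOne (E := E) τ) := fun z hz => by
    have hv := Φ.map_target (x := normalize z) hz
    refine hχ.mem_jetOne hv ?_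
    rw [Function.comp_apply, ← hχ.snd_fst_tangentChart hv, Φ.right_inv (x := normalize z) hz]
  have hξΦ := hξ.smooth.comp
    (hΦ.contMDiffOn_symm.comp hnormalize.contMDiff.contMDiffOn fun z hz => hz) hjet
  have hΦξ := (contMDiffOn_prodMk_mfderiv hΦ.contMDiffOn Φ.open_source).comp hξΦ fun z hz =>
    Φ.map_target (x := normalize z) hz
  exact hΦξ.contDiffOn.snd.snd.snd

theorem exists_contMDiffOn_mem_holonomicExtensions (hτ : ContMDiff 𝓘(ℝ, E) 𝓘(ℝ, ℝ) ∞ τ)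
    (hξ : IsHolonomicConnection (E := E) τ ξ) :
    ∃ Ξ : ∀ v : TangentBundle 𝓘(ℝ, E) Q, TangentSpace 𝓘(ℝ, E).tangent v,
      ContMDiffOn 𝓘(ℝ, E).tangent 𝓘(ℝ, E).tangent.tangent ∞
        (fun v => (⟨v, Ξ v⟩ : TangentBundle 𝓘(ℝ, E).tangent (TangentBundle 𝓘(ℝ, E) Q)))
        hχ.tangentChart.source ∧
      ∀ v ∈ hχ.tangentChart.source, Ξ v ∈ holonomicExtensions (E := E) τ ξ v := by
  have hΦ := hχ.isSmoothChart_tangentChart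
  obtain ⟨Ξ, hΞ, hcoord⟩ := hΦ.exists_contMDiffOn_mfderiv_eq (contDiff_snd.contDiffOn.prodMk
    (contDiffOn_const.prodMk (hχ.contDiffOn_verticalAcceleration hξ)))
  refine ⟨Ξ, hΞ, fun v hv => ?_⟩
  obtain ⟨hproj, htDDot, -⟩ := (hχ.mfderiv_tangentChart_eq_iff hv).1 (hcoord v hv)
  refine ⟨hproj, htDDot, fun hvJ => hΦ.mdifferentiable.mfderiv_injective hv ?_⟩
  have hξv := hξ.holonomic v hvJ
  have hv1 := tDot_of_mem_jetOne (hτ.mdifferentiable (by simp)) hvJ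
  have hξcoord := (hχ.mfderiv_tangentChart_eq_iff hv).2 ⟨mfderiv_proj_of_mem_jetTwo hξv,
    tDDot_of_mem_jetTwo hτ hξv, (hχ.verticalAcceleration_tangentChart hv hv1).symm⟩
  exact (hcoord v hv).trans hξcoord.symm

end IsAdaptedChart

end LocalExtension

section GlobalExtension

variable {E : Type*} [NormedAddCommGroup E] [NormedSpace ℝ E]
  {Q : Type*} [TopologicalSpace Q] [ChartedSpace E Q] [IsManifold 𝓘(ℝ, E) ∞ Q]
  {τ : Q → ℝ} {ξ Ξ : ∀ v : TangentBundle 𝓘(ℝ, E) Q, TangentSpace 𝓘(ℝ, E).tangent v}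

theorem exists_contMDiff_mem_holonomicExtensions [FiniteDimensional ℝ E] [T2Space Q]
    [SecondCountableTopology Q] (hτ : IsSubmersion 𝓘(ℝ, E) 𝓘(ℝ, ℝ) ∞ τ)
    (hξ : IsHolonomicConnection (E := E) τ ξ) :
    ∃ Ξ : ∀ v : TangentBundle 𝓘(ℝ, E) Q, TangentSpace 𝓘(ℝ, E).tangent v,
      ContMDiff 𝓘(ℝ, E).tangent 𝓘(ℝ, E).tangent.tangent ∞
        (fun v => (⟨v, Ξ v⟩ : TangentBundle 𝓘(ℝ, E).tangent (TangentBundle 𝓘(ℝ, E) Q))) ∧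
      ∀ v, Ξ v ∈ holonomicExtensions (E := E) τ ξ v := by
  have : ProperSpace E := FiniteDimensional.proper_real E
  have : LocallyCompactSpace (ModelProd E E) := inferInstanceAs (LocallyCompactSpace (E × E))
  have : LocallyCompactSpace (TangentBundle 𝓘(ℝ, E) Q) :=
    ChartedSpace.locallyCompactSpace (ModelProd E E) _
  have : T2Space (TangentBundle 𝓘(ℝ, E) Q) := t2Space_totalSpace
  have : SecondCountableTopology (TangentBundle 𝓘(ℝ, E) Q) := secondCountableTopology_totalSpace
  obtain ⟨Ξ, hΞ⟩ := exists_contMDiffSection_forall_mem_convex_of_local (n := ⊤)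
    𝓘(ℝ, E).tangent
    (TangentSpace 𝓘(ℝ, E).tangent : TangentBundle 𝓘(ℝ, E) Q → Type _)
    (holonomicExtensions (E := E) τ ξ) convex_holonomicExtensions fun v => by
      obtain ⟨χ, hv, hχ⟩ := exists_adaptedChart (hτ.isSubmersionOfComplement_complement v.proj)
      obtain ⟨Ξ, hsmooth, hΞ⟩ := hχ.exists_contMDiffOn_mem_holonomicExtensions hτ.contMDiff hξ
      exact ⟨_, hχ.tangentChart.open_source.mem_nhds hv, Ξ, hsmooth, hΞ⟩
  exact ⟨Ξ, Ξ.contMDiff, hΞ⟩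

theorem dynamicEquation_eq_unitTimeEquation (hτ : IsSubmersion 𝓘(ℝ, E) 𝓘(ℝ, ℝ) ∞ τ)
    (hξ : IsHolonomicConnection (E := E) τ ξ)
    (hΞ : ∀ v ∈ jetOne (E := E) τ, Ξ v = ξ v) :
    dynamicEquation (E := E) τ ξ = unitTimeEquation (E := E) τ Ξ := by
  ext w
  constructor
  · rintro ⟨v, hv, rfl⟩
    exact ⟨⟨v, congrArg (TotalSpace.mk v) (hΞ v hv)⟩,
      tDDot_of_mem_jetTwo hτ.contMDiff (hξ.holonomic v hv), (mem_jetOne_iff hτ).1 hv⟩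
  · rintro ⟨⟨v, rfl⟩, -, hv⟩
    have hvJ := (mem_jetOne_iff hτ).2 hv
    exact ⟨v, hvJ, congrArg (TotalSpace.mk v) (hΞ v hvJ).symm⟩

end GlobalExtension

section Solutions

variable {E : Type*} [NormedAddCommGroup E] [NormedSpace ℝ E]
  {Q : Type*} [TopologicalSpace Q] [ChartedSpace E Q]
  {τ : Q → ℝ} {c : ℝ → Q} {J : Set ℝ}

theorem mfderiv_comp_sub_const {V : Type*} [NormedAddCommGroup V] [NormedSpace ℝ V]
    {H : Type*} [TopologicalSpace H] {I : ModelWithCorners ℝ E H}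
    {N : Type*} [TopologicalSpace N] [ChartedSpace H N] (f : V → N) (a x : V) :
    mfderiv 𝓘(ℝ, V) I (fun y => f (y - a)) x = mfderiv 𝓘(ℝ, V) I f (x - a) := by
  have hcomp {g : V → N} {b y : V} (hg : MDifferentiableAt 𝓘(ℝ, V) I g (y - b)) :
      HasMFDerivAt 𝓘(ℝ, V) I (fun z => g (z - b)) y (mfderiv 𝓘(ℝ, V) I g (y - b)) :=
    hg.hasMFDerivAt.comp y ((hasFDerivAt_id y).sub_const b).hasMFDerivAt
  by_cases hf : MDifferentiableAt 𝓘(ℝ, V) I f (x - a)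
  · exact (hcomp hf).mfderiv
  · have hf' : ¬ MDifferentiableAt 𝓘(ℝ, V) I (fun y => f (y - a)) x := fun h => hf <| by
      have h' : MDifferentiableAt 𝓘(ℝ, V) I (fun y => f (y - a)) (x - a - -a) := by simpa using h
      simpa using (hcomp h').mdifferentiableAt
    rw [mfderiv_zero_of_not_mdifferentiableAt hf, mfderiv_zero_of_not_mdifferentiableAt hf']
    rfl

theorem velocity_comp_sub_const (c : ℝ → Q) (a t : ℝ) :
    velocity (E := E) (fun s => c (s - a)) t = velocity (E := E) c (t - a) :=
  congrArg (TotalSpace.mk (c (t - a))) (DFunLike.congr_fun (mfderiv_comp_sub_const c a t) (1 : ℝ))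

variable [IsManifold 𝓘(ℝ, E) ∞ Q]
  {Ξ : ∀ v : TangentBundle 𝓘(ℝ, E) Q, TangentSpace 𝓘(ℝ, E).tangent v}

theorem acceleration_comp_sub_const (c : ℝ → Q) (a t : ℝ) :
    acceleration (E := E) (fun s => c (s - a)) t = acceleration (E := E) c (t - a) := by
  rw [acceleration, funext (velocity_comp_sub_const c a)]
  exact congrArg (TotalSpace.mk (velocity (E := E) c (t - a)))
    (DFunLike.congr_fun (mfderiv_comp_sub_const (velocity (E := E) c) a t) (1 : ℝ))

theorem IsSolution.comp_sub_const
    {S : Set (TangentBundle 𝓘(ℝ, E).tangent (TangentBundle 𝓘(ℝ, E) Q))}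
    (hc : IsSolution (E := E) S J c) (a : ℝ) :
    IsSolution (E := E) S ((fun s => s + a) '' J) (fun s => c (s - a)) := by
  have hsub : ContDiff ℝ ∞ fun s : ℝ => s - a := by fun_prop
  refine ⟨hc.1.comp hsub.contMDiff.contMDiffOn ?_, ?_⟩
  · rintro _ ⟨s, hs, rfl⟩
    simpa using hs
  · rintro _ ⟨s, hs, rfl⟩
    rw [acceleration_comp_sub_const, add_sub_cancel_right]
    exact hc.2 s hs

theorem IsSolution.exists_time_eq_add (hτ : MDifferentiable 𝓘(ℝ, E) 𝓘(ℝ, ℝ) τ)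
    (hc : IsSolution (unitTimeEquation (E := E) τ Ξ) J c) (hJ : IsOpen J)
    (hJ' : J.OrdConnected) : ∃ a, ∀ s ∈ J, τ (c s) = s + a := by
  have hcJ (s : ℝ) (hs : s ∈ J) : MDifferentiableAt 𝓘(ℝ, ℝ) 𝓘(ℝ, E) c s :=
    (hc.1.contMDiffAt (hJ.mem_nhds hs)).mdifferentiableAt (by simp)
  have hderiv (s : ℝ) (hs : s ∈ J) : deriv (τ ∘ c) s = 1 :=
    (tDot_velocity hτ (hcJ s hs)).symm.trans (hc.2 s hs).2.2
  have hdiff : DifferentiableOn ℝ (τ ∘ c) J := fun s hs =>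
    ((hτ _).comp s (hcJ s hs)).differentiableAt.differentiableWithinAt
  obtain ⟨a, ha⟩ := hJ.exists_eq_add_of_deriv_eq hJ'.isPreconnected hdiff differentiableOn_id
    fun s hs => by rw [hderiv s hs, deriv_id]
  exact ⟨a, ha⟩

end Solutions

end TimeMechanics

end

theorem proposition3p1_general
    {E : Type*} [NormedAddCommGroup E] [NormedSpace ℝ E] [FiniteDimensional ℝ E]
    {Q : Type*} [TopologicalSpace Q] [T2Space Q] [SecondCountableTopology Q]
    [ChartedSpace E Q] [IsManifold 𝓘(ℝ, E) ∞ Q]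
    (τ : Q → ℝ) (hτ : Manifold.IsSubmersion 𝓘(ℝ, E) 𝓘(ℝ, ℝ) ∞ τ)
    (ξ : ∀ v : TangentBundle 𝓘(ℝ, E) Q, TangentSpace 𝓘(ℝ, E).tangent v)
    (hξ : TimeMechanics.IsHolonomicConnection (E := E) τ ξ) :
    ∃ Ξ : ∀ v : TangentBundle 𝓘(ℝ, E) Q, TangentSpace 𝓘(ℝ, E).tangent v,
      TimeMechanics.IsHolonomicField (E := E) Ξ ∧
      (∀ v : TangentBundle 𝓘(ℝ, E) Q, TimeMechanics.tDDot (E := E) τ ⟨v, Ξ v⟩ = 0) ∧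
      (∀ v ∈ TimeMechanics.jetOne (E := E) τ, Ξ v = ξ v) ∧
      TimeMechanics.dynamicEquation (E := E) τ ξ =
        TimeMechanics.unitTimeEquation (E := E) τ Ξ ∧
      (∀ J : Set ℝ, IsOpen J → J.OrdConnected → ∀ c : ℝ → Q,
        (TimeMechanics.IsMotion (E := E) τ ξ J c ↔
          TimeMechanics.IsSolution (TimeMechanics.unitTimeEquation (E := E) τ Ξ) J c ∧
            ∀ s ∈ J, τ (c s) = s) ∧
        (TimeMechanics.IsSolution (TimeMechanics.unitTimeEquation (E := E) τ Ξ) J c →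
          ∃ a : ℝ, TimeMechanics.IsMotion (E := E) τ ξ
            ((fun s => s + a) '' J) (fun s => c (s - a)))) := by
  obtain ⟨Ξ, hsmooth, hΞ⟩ := TimeMechanics.exists_contMDiff_mem_holonomicExtensions hτ hξ
  have hext v := (hΞ v).2.2
  have heq := TimeMechanics.dynamicEquation_eq_unitTimeEquation hτ hξ hext
  refine ⟨Ξ, ⟨hsmooth, fun v => (hΞ v).1⟩, fun v => (hΞ v).2.1, hext, heq,
    fun J hJ hJ' c => ⟨?_, fun hc => ?_⟩⟩
  · rw [TimeMechanics.IsMotion, heq, and_comm]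
  · obtain ⟨a, ha⟩ := hc.exists_time_eq_add (hτ.contMDiff.mdifferentiable (by simp)) hJ hJ'
    refine ⟨a, ?_, heq ▸ hc.comp_sub_const a⟩
    rintro _ ⟨s, hs, rfl⟩
    simpa using ha s hs

theorem proposition3p1
    {E : Type*} [NormedAddCommGroup E] [NormedSpace ℝ E] [FiniteDimensional ℝ E]
    {Q : Type*} [TopologicalSpace Q] [T2Space Q] [SecondCountableTopology Q]
    [ChartedSpace E Q] [IsManifold 𝓘(ℝ, E) ∞ Q]
    {F : Type*} [NormedAddCommGroup F] [NormedSpace ℝ F] [FiniteDimensional ℝ F]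
    {M : Type*} [TopologicalSpace M] [ChartedSpace F M] [IsManifold 𝓘(ℝ, F) ∞ M]
    (τ : Q → ℝ) (hτ : TimeMechanics.IsFibreBundle (E := E) F M τ)
    (ξ : ∀ v : TangentBundle 𝓘(ℝ, E) Q, TangentSpace 𝓘(ℝ, E).tangent v)
    (hξ : TimeMechanics.IsHolonomicConnection (E := E) τ ξ) :
    ∃ Ξ : ∀ v : TangentBundle 𝓘(ℝ, E) Q, TangentSpace 𝓘(ℝ, E).tangent v,
      -- `Ξ` is a holonomic vector field on `TQ` with `Ξ⁰ = 0`
      TimeMechanics.IsHolonomicField (E := E) Ξ ∧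
      (∀ v : TangentBundle 𝓘(ℝ, E) Q, TimeMechanics.tDDot (E := E) τ ⟨v, Ξ v⟩ = 0) ∧
      -- it extends `Tλ ∘ λ₂ ∘ ξ` from `J¹Q` to `TQ`
      (∀ v ∈ TimeMechanics.jetOne (E := E) τ, Ξ v = ξ v) ∧
      -- the two equations coincide as subsets of `TTQ`
      TimeMechanics.dynamicEquation (E := E) τ ξ =
        TimeMechanics.unitTimeEquation (E := E) τ Ξ ∧
      -- the two equations have the same solutions, up to the choice of the origin of time
      (∀ J : Set ℝ, IsOpen J → J.OrdConnected → ∀ c : ℝ → Q,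
        (TimeMechanics.IsMotion (E := E) τ ξ J c ↔
          TimeMechanics.IsSolution (TimeMechanics.unitTimeEquation (E := E) τ Ξ) J c ∧
            ∀ s ∈ J, τ (c s) = s) ∧
        (TimeMechanics.IsSolution (TimeMechanics.unitTimeEquation (E := E) τ Ξ) J c →
          ∃ a : ℝ, TimeMechanics.IsMotion (E := E) τ ξ
            ((fun s => s + a) '' J) (fun s => c (s - a)))) :=
  proposition3p1_general τ hτ.isSubmersion ξ hξ
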